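/- Let \(F\) be an ordered field and let \(I\) be an integer part of \(F\), that is, a subring of \(F\) with no element strictly between \(0\) and \(1\) such that for every \(x\in F\) there is a (necessarily unique) \(a=\lfloor x\rfloor\in I\) with \(a\le x<a+1\). Let \(\mathrm{Frac}(I)\subseteq F\) be the fraction field of \(I\); the elements of \(F\setminus \mathrm{Frac}(I)\) are called irrational. For \(S\subseteq F\) write \(S^{>0}\) and \(S^{\ge 0}\) for its sets of positive and of non-negative elements. Suppose that \(I\models IE_1\), i.e. that \(I\) satisfies induction \[\varphi(0,\bar x)\wedge\forall y\ge 0\,(\varphi(y,\bar x)\to\varphi(y+1,\bar x))\ \to\ \forall y\ge 0\,\varphi(y,\bar x)\] for all parameters \(\bar x\) in \(I\) and all bounded existential formulas \(\varphi(\bar w)\), i.e. formulas \(\exists \bar z\,(0\le \bar z\le t(\bar w)\wedge\theta(\bar w,\bar z))\) with \(t\) a term and \(\theta\) a quantifier-free formula in the language \(\{+,-,\cdot,0,1,\le\}\) of ordered rings. Then the following hold. 1. (Dirichlet's theorem) If \(\alpha\in F\setminus\mathrm{Frac}(I)\), then for every \(Q\in I^{>0}\) there are \(h,k\in I\) with \(k>Q\)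 and \(\left|\alpha-\frac hk\right|<\frac1{k^2}\). 2. (DMO) If \(F\ne\mathrm{Frac}(I)\), then \(\langle F,I\rangle\) has the property DMO: for every irrational \(\alpha\in F\), the set \(\{n\alpha-\lfloor n\alpha\rfloor : n\in I^{\ge0}\}\) is dense in \([0,1)_F\), i.e. it has an element strictly between any two elements \(l<r\) of \([0,1]_F\). 3. (Property \(\mathbb P\)) For every irrational \(\alpha>1\) the set \(N_\alpha=\{\lfloor n\alpha\rfloor : n\in I^{\ge0}\}\) meets every arithmetical progression \(\{mt+k : t\in I^{\ge0}\}\) with \(m,k\in I\), \(0\le k<m\), in a non-zero element. 4. (Separability) For all \(\alpha,\beta\in F\) with \(\alpha,\beta\ge1\): \(N_\alpha\ne N_\beta\) if and only if \(\alpha\ne\beta\). -/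

import Mathlib

namespace SkolemBang

open FirstOrder FirstOrder.Language

/-- The language `{+, -, ·, 0, 1, ≤}` of ordered rings. -/
abbrev orderedRingLang : FirstOrder.Language :=
  Language.ring.sum Language.order

/-- An ordered ring, with its own operations and its own order, as a first-order structure. -/
instance orderedRingStructure (R : Type*) [Ring R] [LE R] : orderedRingLang.Structure R :=
  letI : Language.ring.Structure R := (FirstOrder.Ring.compatibleRingOfRing R).toStructure
  letI : Language.order.Structure R := FirstOrder.Language.orderStructure R
  Language.sumStructure Language.ring Language.order R

/-- An `E₁`-formula `∃ z₁, …, zₙ ≤ t(x), φ(x, z)` in the free variables `x = (x₀, …, xₘ₋₁)`: `t` is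
a term in which the bound variables `z` do not occur, and `φ` is open (quantifier free).
For `n = 0` it is an open formula. -/
structure E1Formula (m : ℕ) where
  /-- the number of variables bound by the block of quantifiers -/
  n : ℕ
  /-- the term `t(x)` that bounds the quantifiers -/
  bound : orderedRingLang.Term (Fin m)
  /-- the formula `φ(x, z)` -/
  matrix : orderedRingLang.Formula (Fin m ⊕ Fin n)
  /-- `φ` is open -/
  isOpen : matrix.IsQF

/-- Satisfaction of an `E₁`-formula. As usual in arithmetic, a bounded quantifier `∃ z ≤ t` ranges
over the non-negative elements `z ≤ t`. -/
def E1Formula.Realize {m : ℕ} (ψ : E1Formula m) {R : Type*} [Ring R] [LE R] (x : Fin m → R) :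
    Prop :=
  ∃ z : Fin ψ.n → R, (∀ i, 0 ≤ z i ∧ z i ≤ ψ.bound.realize x) ∧ ψ.matrix.Realize (Sum.elim x z)

/-- `DOR` for a ring that is already known to be ordered: no element lies strictly between
`0` and `1`. -/
def IsDiscretelyOrdered (R : Type*) [Ring R] [LT R] : Prop :=
  ∀ x : R, ¬ (0 < x ∧ x < 1)

/-- `R ⊨ IE₁`: `R` is a discretely ordered ring that satisfies the induction scheme, along its
non-negative elements, for all `E₁`-formulas `φ(y, x₁, …, xₚ)` with arbitrary parameters `xᵢ`.
The induction variable `y` is the variable of index `0`. -/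
def ModelsIE1 (R : Type*) [CommRing R] [LinearOrder R] [IsStrictOrderedRing R] : Prop :=
  IsDiscretelyOrdered R ∧
    ∀ (p : ℕ) (ψ : E1Formula (p + 1)) (x : Fin p → R),
      ψ.Realize (Fin.cons 0 x : Fin (p + 1) → R) →
      (∀ y : R, 0 ≤ y → ψ.Realize (Fin.cons y x : Fin (p + 1) → R) →
        ψ.Realize (Fin.cons (y + 1) x : Fin (p + 1) → R)) →
      ∀ y : R, 0 ≤ y → ψ.Realize (Fin.cons y x : Fin (p + 1) → R)

section IntegerPart

variable {F : Type*} [Field F] [LinearOrder F]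

/-- `a` is the integer part `⌊x⌋_I` of `x`. -/
def IsFloor (I : Subring F) (x a : F) : Prop :=
  a ∈ I ∧ a ≤ x ∧ x < a + 1

/-- The subring `I` is an integer part of the ordered field `F`. -/
def IsIntegerPart (I : Subring F) : Prop :=
  IsDiscretelyOrdered I ∧ ∀ x : F, ∃ a : F, IsFloor I x a

/-- `Frac(I)`, as a subfield of `F`. -/
def fracField (I : Subring F) : Subfield F :=
  Subfield.closure (I : Set F)

/-- `N_α = {⌊nα⌋_I | n ∈ I, n ≥ 0}`. -/
def floorMultiples (I : Subring F) (α : F) : Set F :=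
  {a | ∃ n ∈ I, 0 ≤ n ∧ IsFloor I (n * α) a}

/-- The arithmetical progression `{m t + k | t ∈ I, t ≥ 0}`. -/
def arithProg (I : Subring F) (m k : F) : Set F :=
  {a | ∃ t ∈ I, 0 ≤ t ∧ a = m * t + k}

/-- `D` is dense modulo one with respect to `I`: the set `{u - ⌊u⌋_I | u ∈ D}` is
dense in `[0,1)`. -/
def DenseModOne (I : Subring F) (D : Set F) : Prop :=
  ∀ l r : F, 0 ≤ l → l < r → r ≤ 1 →
    ∃ s ∈ {s : F | ∃ u ∈ D, ∃ a : F, IsFloor I u a ∧ s = u - a}, l < s ∧ s < r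

/-- `DMO(α)`: the set `{nα | n ∈ I, n ≥ 0}` is dense modulo one. -/
def DMOAt (I : Subring F) (α : F) : Prop :=
  DenseModOne I {u | ∃ n ∈ I, 0 ≤ n ∧ u = n * α}

/-- `⟨F, I⟩` satisfies `DMO`: `F` has irrational elements, i.e. elements outside `Frac(I)`,
and `DMO(α)` holds for all of them. -/
def DMO (I : Subring F) : Prop :=
  (∃ α : F, α ∉ fracField I) ∧ ∀ α : F, α ∉ fracField I → DMOAt I α

/-- The property `ℙ`: for every irrational `α > 1`, the set `N_α` intersects every arithmetical
progression `{m t + k | t ∈ I, t ≥ 0}`, `0 ≤ k < m`. As `0` is always in `N_α`, the common element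
is required to be different from `0`. -/
def PropertyP (I : Subring F) : Prop :=
  ∀ α : F, α ∉ fracField I → 1 < α →
    ∀ m ∈ I, ∀ k ∈ I, 0 ≤ k → k < m → ∃ a ∈ floorMultiples I α ∩ arithProg I m k, a ≠ 0

/-- `⟨F, I⟩` is separable. -/
def Separable (I : Subring F) : Prop :=
  ∀ α β : F, 1 ≤ α → 1 ≤ β → (floorMultiples I α ≠ floorMultiples I β ↔ α ≠ β)

end IntegerPart

end SkolemBang

/-!
The whole argument rests on Farey neighbours. In a model `I` of `IE₁`, every fraction `a / b` has
neighbours `p / q ≤ a / b < p' / q'` of every order `N ∈ I`, that is, with `p' q - p q' = 1`,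
`q, q' ≤ N` and `q + q' > N`: this is proved by induction on `N`, inserting mediants, and the
statement is an `E₁`-formula (`ModelsIE1.exists_farey`). As `Frac(I)` is dense in `F`, neighbours
exist for every `α ∈ F` (`exists_isFareyPair`). No fraction of denominator at most `N` lies strictly
between them (`IsFareyPair.left_or_right`).

* One of the two neighbours of an irrational `α` is a good approximation `h / k`, by comparison of
  `α` with the mediant. Since the neighbours of order `Q` keep `α` away from all fractions with
  denominators up to `Q`, letting `N` grow gives arbitrarily large `k`; moreover `h` is invertible
  modulo `k` (`exists_coprime_approx_gt`). This is Dirichlet's theorem.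
* Since `h` is invertible modulo `k`, the multiples `n h / k`, `0 ≤ n < k`, run modulo one through
  all `c / k`, and `nα` differs from `n h / k` by less than `1 / k`. So `DMO` holds, and `ℙ` is `DMO`
  for `α / m`.
* The floors `⌊nα⌋`, `n ≤ M`, do not change if `α` is replaced by its left neighbour of order `M`.
  So `⌊nα⌋ = ⌊nβ⌋`, for `n ≤ M`, is an `E₁`-statement about `n` with parameters in `I`. If
  `N_α = N_β`, it is proved by induction, as `⌊(n + 1)α⌋` is the successor of `⌊nα⌋` in `N_α`. Hence
  `M |α - β| < 1` for all `M`, and `α = β`.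
-/

namespace SkolemBang

open FirstOrder FirstOrder.Language

/-! ### Induction for predicates defined by `E₁`-formulas -/

section Representability

variable {R : Type*} [CommRing R] [LinearOrder R]

/-- `f` is the function defined by a term with variables indexed by `ι`. -/
def IsTermFun {ι : Type} (f : (ι → R) → R) : Prop :=
  ∃ t : orderedRingLang.Term ι, ∀ v, t.realize v = f v

/-- `θ` is the predicate defined by an open (quantifier free) formula with variables indexed
by `ι`. -/
def IsOpenPred {ι : Type} (θ : (ι → R) → Prop) : Prop :=
  ∃ φ : orderedRingLang.Formula ι, φ.IsQF ∧ ∀ v, φ.Realize v ↔ θ v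

variable {ι : Type} {f g : (ι → R) → R} {θ η : (ι → R) → Prop}

theorem IsTermFun.var (i : ι) : IsTermFun (fun v : ι → R => v i) :=
  ⟨Term.var i, fun _ => rfl⟩

theorem IsTermFun.one : IsTermFun (fun _ : ι → R => (1 : R)) :=
  ⟨Term.func (Sum.inl ringFunc.one : orderedRingLang.Functions 0) ![], fun _ => rfl⟩

theorem IsTermFun.add (hf : IsTermFun f) (hg : IsTermFun g) :
    IsTermFun (fun v => f v + g v) := by
  obtain ⟨s, hs⟩ := hf
  obtain ⟨t, ht⟩ := hg
  refine ⟨Term.func (Sum.inl ringFunc.add : orderedRingLang.Functions 2) ![s, t], fun v => ?_⟩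
  exact congrArg₂ (· + ·) (hs v) (ht v)

theorem IsTermFun.mul (hf : IsTermFun f) (hg : IsTermFun g) :
    IsTermFun (fun v => f v * g v) := by
  obtain ⟨s, hs⟩ := hf
  obtain ⟨t, ht⟩ := hg
  refine ⟨Term.func (Sum.inl ringFunc.mul : orderedRingLang.Functions 2) ![s, t], fun v => ?_⟩
  exact congrArg₂ (· * ·) (hs v) (ht v)

theorem IsOpenPred.le (hf : IsTermFun f) (hg : IsTermFun g) :
    IsOpenPred (fun v => f v ≤ g v) := by
  obtain ⟨s, hs⟩ := hf
  obtain ⟨t, ht⟩ := hg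
  refine ⟨Relations.formula₂ (Sum.inr leSymb : orderedRingLang.Relations 2) s t,
    (BoundedFormula.IsAtomic.rel _ _).isQF, fun v => ?_⟩
  refine Formula.realize_rel₂.trans ?_
  change s.realize v ≤ t.realize v ↔ f v ≤ g v
  rw [hs, ht]

theorem IsOpenPred.and (hθ : IsOpenPred θ) (hη : IsOpenPred η) :
    IsOpenPred (fun v => θ v ∧ η v) := by
  obtain ⟨φ, hφ, h⟩ := hθ
  obtain ⟨ψ, hψ, h'⟩ := hη
  exact ⟨φ ⊓ ψ, hφ.inf hψ, fun v => Formula.realize_inf.trans (and_congr (h v) (h' v))⟩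

theorem IsOpenPred.or (hθ : IsOpenPred θ) (hη : IsOpenPred η) :
    IsOpenPred (fun v => θ v ∨ η v) := by
  obtain ⟨φ, hφ, h⟩ := hθ
  obtain ⟨ψ, hψ, h'⟩ := hη
  exact ⟨φ ⊔ ψ, hφ.sup hψ, fun v => Formula.realize_sup.trans (or_congr (h v) (h' v))⟩

/-- Induction in a model of `IE₁` for a predicate of the form `∃ z ≤ f(y, x), θ(y, x, z)`, with `f`
a term function and `θ` an open predicate. -/
theorem ModelsIE1.induction [IsStrictOrderedRing R] (hR : ModelsIE1 R) {p n : ℕ} (x : Fin p → R)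
    {f : (Fin (p + 1) → R) → R} (hf : IsTermFun f)
    {θ : (Fin (p + 1) ⊕ Fin n → R) → Prop} (hθ : IsOpenPred θ) {P : R → Prop}
    (hP : ∀ y, P y ↔ ∃ z : Fin n → R, (∀ i, 0 ≤ z i ∧ z i ≤ f (Fin.cons y x)) ∧
      θ (Sum.elim (Fin.cons y x) z))
    (zero : P 0) (succ : ∀ y, 0 ≤ y → P y → P (y + 1)) (y : R) (hy : 0 ≤ y) : P y := by
  obtain ⟨t, ht⟩ := hf
  obtain ⟨φ, hφ, h⟩ := hθ
  have key : ∀ y, (E1Formula.mk n t φ hφ).Realize (Fin.cons y x : Fin (p + 1) → R) ↔ P y := by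
    intro y
    simp only [hP, E1Formula.Realize, ht, h]
  have := hR.2 p ⟨n, t, φ, hφ⟩ x
  simp only [key] at this
  exact this zero succ y hy

end Representability

/-! ### Farey neighbours of fractions and common floors by induction -/

section Discrete

variable {R : Type*} [CommRing R] [LinearOrder R] [IsStrictOrderedRing R]

theorem IsDiscretelyOrdered.add_one_le (hR : IsDiscretelyOrdered R) {a b : R} (h : a < b) :
    a + 1 ≤ b := by
  by_contra! h'
  exact hR (b - a) ⟨by linarith, by linarith⟩

theorem IsDiscretelyOrdered.le_of_lt_add_one (hR : IsDiscretelyOrdered R) {a b : R}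
    (h : a < b + 1) : a ≤ b := by
  by_contra! h'
  linarith [hR.add_one_le h']

/-- Farey neighbours of a fraction `a / b ∈ [0, 1)` among the fractions with denominators at most
`N`, by induction on `N`: the mediant of the neighbours of order `N` either has too large a
denominator for order `N + 1`, or it replaces one of them. Numerators and denominators are bounded
by `N`, so that this is an `E₁`-statement. -/
theorem ModelsIE1.exists_farey (hR : ModelsIE1 R) {a b : R} (ha : 0 ≤ a) (hab : a < b)
    {N : R} (hN : 1 ≤ N) :
    ∃ p q p' q' : R, 1 ≤ q ∧ 1 ≤ q' ∧ q ≤ N ∧ q' ≤ N ∧ N + 1 ≤ q + q' ∧ p' * q = p * q' + 1 ∧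
      p * b ≤ a * q ∧ a * q' + 1 ≤ p' * b := by
  let P : R → Prop := fun y => ∃ p q p' q' : R,
    (0 ≤ p ∧ p ≤ y + 1) ∧ (0 ≤ q ∧ q ≤ y + 1) ∧ (0 ≤ p' ∧ p' ≤ y + 1) ∧ (0 ≤ q' ∧ q' ≤ y + 1) ∧
    1 ≤ q ∧ 1 ≤ q' ∧ y + 1 + 1 ≤ q + q' ∧ p' * q ≤ p * q' + 1 ∧ p * q' + 1 ≤ p' * q ∧
      p * b ≤ a * q ∧ a * q' + 1 ≤ p' * b
  have key : ∀ y, 0 ≤ y → P y := by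
    -- the free variables are `(y, a, b)`, the bound ones `(p, q, p', q')`
    refine hR.induction (p := 2) (n := 4) ![a, b] (f := fun v => v 0 + 1)
      (θ := fun w => 1 ≤ w (.inr 1) ∧ 1 ≤ w (.inr 3) ∧
        w (.inl 0) + 1 + 1 ≤ w (.inr 1) + w (.inr 3) ∧
        w (.inr 2) * w (.inr 1) ≤ w (.inr 0) * w (.inr 3) + 1 ∧
        w (.inr 0) * w (.inr 3) + 1 ≤ w (.inr 2) * w (.inr 1) ∧
        w (.inr 0) * w (.inl 2) ≤ w (.inl 1) * w (.inr 1) ∧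
        w (.inl 1) * w (.inr 3) + 1 ≤ w (.inr 2) * w (.inl 2)) ?_ ?_ ?_ ?_ ?_
    · exact (IsTermFun.var 0).add .one
    · have V := fun i => IsTermFun.var (R := R) (ι := Fin (2 + 1) ⊕ Fin 4) i
      have O := IsTermFun.one (R := R) (ι := Fin (2 + 1) ⊕ Fin 4)
      exact (IsOpenPred.le O (V _)).and <| (IsOpenPred.le O (V _)).and <|
        (IsOpenPred.le (((V _).add O).add O) ((V _).add (V _))).and <|
        (IsOpenPred.le ((V _).mul (V _)) (((V _).mul (V _)).add O)).and <|
        (IsOpenPred.le (((V _).mul (V _)).add O) ((V _).mul (V _))).and <|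
        (IsOpenPred.le ((V _).mul (V _)) ((V _).mul (V _))).and <|
        IsOpenPred.le (((V _).mul (V _)).add O) ((V _).mul (V _))
    · intro y
      constructor
      · rintro ⟨p, q, p', q', h1, h2, h3, h4, h⟩
        refine ⟨![p, q, p', q'], fun i => ?_, h⟩
        fin_cases i
        exacts [h1, h2, h3, h4]
      · rintro ⟨z, hz, h⟩
        exact ⟨z 0, z 1, z 2, z 3, hz 0, hz 1, hz 2, hz 3, h⟩
    · refine ⟨0, 1, 1, 1, ?_⟩
      have := hR.1.add_one_le hab
      norm_num
      exact ⟨ha, this⟩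
    · rintro y hy ⟨p, q, p', q', ⟨h1, h1'⟩, ⟨h2, h2'⟩, ⟨h3, h3'⟩, ⟨h4, h4'⟩, hq, hq', hN, hd, hd',
        hl, hr⟩
      by_cases hlt : y + 1 + 1 < q + q'
      · exact ⟨p, q, p', q', ⟨h1, by linarith⟩, ⟨h2, by linarith⟩, ⟨h3, by linarith⟩,
          ⟨h4, by linarith⟩, hq, hq', hR.1.add_one_le hlt, hd, hd', hl, hr⟩
      · have hpp : p + p' ≤ q + q' := by
          -- `p / q ≤ a / b < 1`, so that `p < q` and `p' ≤ q'`
          have hpq : p + 1 ≤ q := by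
            refine hR.1.add_one_le ?_
            by_contra! hc
            nlinarith [mul_le_mul_of_nonneg_right hc (ha.trans hab.le)]
          have : p' ≤ q' := by
            refine hR.1.le_of_lt_add_one ?_
            by_contra! hc
            nlinarith [mul_le_mul_of_nonneg_right hc h2, mul_le_mul_of_nonneg_right hpq h4]
          linarith
        rcases le_or_gt ((p + p') * b) (a * (q + q')) with hm | hm
        · exact ⟨p + p', q + q', p', q', ⟨by linarith, by linarith⟩, ⟨by linarith, by linarith⟩,
            ⟨h3, by linarith⟩, ⟨h4, by linarith⟩, by linarith, hq', by linarith,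
            by linarith, by linarith, hm, hr⟩
        · exact ⟨p, q, p + p', q + q', ⟨h1, by linarith⟩, ⟨h2, by linarith⟩,
            ⟨by linarith, by linarith⟩, ⟨by linarith, by linarith⟩, hq, by linarith, by linarith,
            by linarith, by linarith, hl, hR.1.add_one_le hm⟩
  obtain ⟨p, q, p', q', -, ⟨-, h2⟩, -, ⟨-, h4⟩, h5, h6, h7, h8, h9, h10, h11⟩ :=
    key (N - 1) (by linarith)
  exact ⟨p, q, p', q', h5, h6, by linarith, by linarith, by linarith, le_antisymm h8 h9, h10, h11⟩

/-- Induction up to `M` for the `E₁`-statement that `n a / b` and `n a' / b'` have the same floor.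
The disjunct `M < n` in the induction formula makes the hypothesis `step` sufficient. -/
theorem ModelsIE1.exists_common_floor (hR : ModelsIE1 R) {a b a' b' M : R}
    (ha : 0 ≤ a) (hb : 1 ≤ b) (hb' : 1 ≤ b')
    (step : ∀ n c, 0 ≤ n → n + 1 ≤ M → 0 ≤ c →
      c * b ≤ n * a → n * a + 1 ≤ (c + 1) * b → c * b' ≤ n * a' → n * a' + 1 ≤ (c + 1) * b' →
      ∃ d, 0 ≤ d ∧ d * b ≤ (n + 1) * a ∧ (n + 1) * a + 1 ≤ (d + 1) * b ∧
        d * b' ≤ (n + 1) * a' ∧ (n + 1) * a' + 1 ≤ (d + 1) * b')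
    {n : R} (hn : 0 ≤ n) (hnM : n ≤ M) :
    ∃ c, c * b ≤ n * a ∧ n * a + 1 ≤ (c + 1) * b ∧
      c * b' ≤ n * a' ∧ n * a' + 1 ≤ (c + 1) * b' := by
  let P : R → Prop := fun n => ∃ c : R, (0 ≤ c ∧ c ≤ n * a) ∧ (M + 1 ≤ n ∨
    (c * b ≤ n * a ∧ n * a + 1 ≤ (c + 1) * b ∧ c * b' ≤ n * a' ∧ n * a' + 1 ≤ (c + 1) * b'))
  have key : ∀ n, 0 ≤ n → P n := by
    -- the free variables are `(n, a, b, a', b', M)`, the bound one is `c`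
    refine hR.induction (p := 5) (n := 1) ![a, b, a', b', M] (f := fun v => v 0 * v 1)
      (θ := fun w => w (.inl 5) + 1 ≤ w (.inl 0) ∨
        (w (.inr 0) * w (.inl 2) ≤ w (.inl 0) * w (.inl 1) ∧
          w (.inl 0) * w (.inl 1) + 1 ≤ (w (.inr 0) + 1) * w (.inl 2) ∧
          w (.inr 0) * w (.inl 4) ≤ w (.inl 0) * w (.inl 3) ∧
          w (.inl 0) * w (.inl 3) + 1 ≤ (w (.inr 0) + 1) * w (.inl 4))) ?_ ?_ ?_ ?_ ?_
    · exact (IsTermFun.var 0).mul (.var 1)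
    · have V := fun i => IsTermFun.var (R := R) (ι := Fin (5 + 1) ⊕ Fin 1) i
      have O := IsTermFun.one (R := R) (ι := Fin (5 + 1) ⊕ Fin 1)
      exact (IsOpenPred.le ((V _).add O) (V _)).or <|
        (IsOpenPred.le ((V _).mul (V _)) ((V _).mul (V _))).and <|
        (IsOpenPred.le (((V _).mul (V _)).add O) (((V _).add O).mul (V _))).and <|
        (IsOpenPred.le ((V _).mul (V _)) ((V _).mul (V _))).and <|
        IsOpenPred.le (((V _).mul (V _)).add O) (((V _).add O).mul (V _))
    · intro y
      constructor
      · rintro ⟨c, h1, h⟩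
        refine ⟨![c], fun i => ?_, h⟩
        fin_cases i
        exact h1
      · rintro ⟨z, hz, h⟩
        exact ⟨z 0, hz 0, h⟩
    · exact ⟨0, by simp, Or.inr ⟨by simp, by simpa using hb, by simp, by simpa using hb'⟩⟩
    · rintro n hn ⟨c, ⟨hc, -⟩, h⟩
      by_cases hM : n + 1 ≤ M
      · rcases h with h | ⟨h1, h2, h3, h4⟩
        · linarith
        · obtain ⟨d, hd, h⟩ := step n c hn hM hc h1 h2 h3 h4
          exact ⟨d, ⟨hd, (le_mul_of_one_le_right hd hb).trans h.1⟩, Or.inr h⟩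
      · exact ⟨0, ⟨le_rfl, by positivity⟩, Or.inl (hR.1.add_one_le (not_le.1 hM))⟩
  obtain ⟨c, -, h | h⟩ := key n hn
  · linarith
  · exact ⟨c, h⟩

end Discrete

/-! ### Farey neighbours of an element of the field -/

section Farey

variable {F : Type*} [Field F] [LinearOrder F] {I : Subring F}

theorem IsIntegerPart.exists_floor (hI : IsIntegerPart I) (x : F) :
    ∃ a : I, (a : F) ≤ x ∧ x < a + 1 := by
  obtain ⟨a, ha, h⟩ := hI.2 x
  exact ⟨⟨a, ha⟩, h⟩

theorem IsIntegerPart.exists_gt (hI : IsIntegerPart I) (x : F) : ∃ a : I, x < a := by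
  obtain ⟨a, -, h⟩ := hI.exists_floor x
  exact ⟨a + 1, by push_cast; exact h⟩

variable [IsStrictOrderedRing F]

theorem IsIntegerPart.add_one_le (hI : IsIntegerPart I) {a b : I} (h : (a : F) < b) :
    (a : F) + 1 ≤ b := by
  exact_mod_cast hI.1.add_one_le (a := a) (b := b) (by exact_mod_cast h)

theorem IsIntegerPart.le_of_lt_add_one (hI : IsIntegerPart I) {a b : I} (h : (a : F) < b + 1) :
    (a : F) ≤ b := by
  by_contra! h'
  linarith [hI.add_one_le h']

/-- `p / q ≤ α < p' / q'` are the neighbours of `α` among the fractions over `I` with denominators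
at most `N`. Being neighbours is encoded by `p' q - p q' = 1` and `q + q' > N`, and all inequalities
are stated without division. -/
structure IsFareyPair (α : F) (N p q p' q' : I) : Prop where
  one_le : (1 : F) ≤ q
  one_le' : (1 : F) ≤ q'
  le : (q : F) ≤ N
  le' : (q' : F) ≤ N
  lt_add : (N : F) + 1 ≤ q + q'
  det : (p' : F) * q = p * q' + 1
  left : (p : F) ≤ α * q
  right : α * q' < p'

/-- No fraction of denominator `0 < k ≤ N` lies strictly between the members of a Farey pair of
order `N`. -/
theorem IsFareyPair.left_or_right {α : F} {N p q p' q' : I} (h : IsFareyPair α N p q p' q')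
    (hI : IsIntegerPart I) {c k : I} (hkN : (k : F) ≤ N) :
    (c : F) * q ≤ p * k ∨ (p' : F) * k ≤ c * q' := by
  by_contra! hc
  have h1 : (p : F) * k + 1 ≤ c * q := by
    exact_mod_cast hI.add_one_le (a := p * k) (b := c * q) (by exact_mod_cast hc.1)
  have h2 : (c : F) * q' + 1 ≤ p' * k := by
    exact_mod_cast hI.add_one_le (a := c * q') (b := p' * k) (by exact_mod_cast hc.2)
  -- the determinant expresses `k` as `q (p' k - c q') + q' (c q - p k)`
  nlinarith [h.det, h.one_le, h.one_le', h.lt_add,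
    mul_le_mul_of_nonneg_right h1 (zero_le_one.trans h.one_le'),
    mul_le_mul_of_nonneg_right h2 (zero_le_one.trans h.one_le), congrArg (· * (k : F)) h.det]

/-- Up to `N`, the multiples of `α` and of its left Farey neighbour `p / q` have the same lower
bounds in `I`. -/
theorem IsFareyPair.le_mul_iff {α : F} {N p q p' q' : I} (h : IsFareyPair α N p q p' q')
    (hI : IsIntegerPart I) {c k : I} (hk : (0 : F) ≤ k) (hkN : (k : F) ≤ N) :
    (c : F) ≤ k * α ↔ (c : F) * q ≤ k * p := by
  have hq : (0 : F) < q := zero_lt_one.trans_le h.one_le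
  have hq' : (0 : F) < q' := zero_lt_one.trans_le h.one_le'
  constructor
  · intro hc
    rcases h.left_or_right hI (c := c) hkN with h1 | h1
    · linarith
    · rcases hk.eq_or_lt with hk0 | hk0
      · rw [← hk0] at hc ⊢
        nlinarith
      · nlinarith [mul_lt_mul_of_pos_right h.right hk0, mul_le_mul_of_nonneg_right hc hq'.le]
  · intro hc
    refine le_of_mul_le_mul_right ?_ hq
    nlinarith [mul_le_mul_of_nonneg_right h.left hk]

/-- Up to `N`, the multiples of `α` and of its left Farey neighbour `p / q` have the same floors. -/
theorem IsFareyPair.isFloor_iff {α : F} {N p q p' q' : I} (h : IsFareyPair α N p q p' q')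
    (hI : IsIntegerPart I) {c k : I} (hk : (0 : F) ≤ k) (hkN : (k : F) ≤ N) :
    IsFloor I (k * α) c ↔ c * q ≤ k * p ∧ k * p + 1 ≤ (c + 1) * q := by
  have h1 := h.le_mul_iff hI (c := c) hk hkN
  have h2 := h.le_mul_iff hI (c := c + 1) hk hkN
  have h3 : k * p < (c + 1) * q ↔ k * p + 1 ≤ (c + 1) * q :=
    ⟨hI.1.add_one_le, fun h => (lt_add_one _).trans_le h⟩
  rw [← h3, ← not_le]
  push_cast at h2
  simp only [IsFloor, SetLike.coe_mem, true_and, ← not_le (a := (c : F) + 1), h1, h2]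
  norm_cast

/-- A Farey pair of a sufficiently close fraction `a / b ≤ α` is one for `α`, unless
`a / b < p' / q' ≤ α`; then `p' / q'` and its right neighbour enclose `α`. -/
theorem exists_isFareyPair_of_floor_eq_zero (hI : IsIntegerPart I) (hIE : ModelsIE1 I) {α : F}
    (h0 : 0 ≤ α) (h1 : α < 1) {N : I} (hN : (1 : F) ≤ N) :
    ∃ p q p' q' : I, IsFareyPair α N p q p' q' := by
  -- a denominator so large that `a / b ≤ α < (a + 1) / b` locates `α` up to `1 / N ^ 2`
  set b : I := N * N with hb
  have hb1 : (1 : F) ≤ b := by rw [hb]; push_cast; nlinarith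
  obtain ⟨a, ha, ha'⟩ := hI.exists_floor (α * b)
  have ha0 : (0 : F) ≤ a := by
    exact_mod_cast hI.le_of_lt_add_one (a := 0) (b := a) (by
      push_cast; exact lt_of_le_of_lt (by positivity) ha')
  have hab : (a : F) < b := by nlinarith
  obtain ⟨p, q, p', q', hq, hq', hqN, hqN', hNq, hd, hl, hr⟩ :=
    hIE.exists_farey (a := a) (b := b) (by exact_mod_cast ha0) (by exact_mod_cast hab)
      (N := N) (by exact_mod_cast hN)
  replace hq : (1 : F) ≤ q := by exact_mod_cast hq
  replace hq' : (1 : F) ≤ q' := by exact_mod_cast hq'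
  replace hqN : (q : F) ≤ N := by exact_mod_cast hqN
  replace hqN' : (q' : F) ≤ N := by exact_mod_cast hqN'
  replace hNq : (N : F) + 1 ≤ q + q' := by exact_mod_cast hNq
  replace hd : (p' : F) * q = p * q' + 1 := by exact_mod_cast hd
  replace hl : (p : F) * b ≤ a * q := by exact_mod_cast hl
  replace hr : (a : F) * q' + 1 ≤ p' * b := by exact_mod_cast hr
  have hb0 : (0 : F) < b := zero_lt_one.trans_le hb1
  rcases lt_or_ge (α * q') p' with hα | hα
  · refine ⟨p, q, p', q', hq, hq', hqN, hqN', hNq, hd, ?_, hα⟩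
    refine le_of_mul_le_mul_right ?_ hb0
    nlinarith
  · -- here `p' / q' ≤ α`: pass to the right neighbour of `p' / q'`
    obtain ⟨t, ht, ht'⟩ := hI.exists_floor (((N : F) + q) / q')
    have hq0 : (0 : F) < q' := zero_lt_one.trans_le hq'
    rw [le_div_iff₀ hq0] at ht
    rw [div_lt_iff₀ hq0] at ht'
    have e1 : ((t * p' - p : I) : F) = t * p' - p := by push_cast; rfl
    have e2 : ((t * q' - q : I) : F) = t * q' - q := by push_cast; rfl
    have hs : (N : F) + 1 ≤ q' + ((t * q' - q : I) : F) := by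
      have := hI.add_one_le (a := N) (b := q' + (t * q' - q)) (by push_cast; linarith)
      push_cast at this ⊢
      exact this
    refine ⟨p', q', t * p' - p, t * q' - q, hq', ?_, hqN', ?_, ?_, ?_, hα, ?_⟩
    · linarith
    · rw [e2]; linarith
    · exact hs
    · rw [e1]; push_cast; linear_combination hd
    · rw [e1, e2]
      have hs1 : (1 : F) ≤ t * q' - q := by rw [← e2]; linarith
      have hsN : t * q' - q ≤ (N : F) := by linarith
      have hss : (t * q' - q) * q' ≤ (b : F) := by
        rw [hb]; push_cast
        exact mul_le_mul hsN hqN' hq0.le (zero_le_one.trans hN)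
      -- `α < (a + 1) / b ≤ p' / q' + 1 / b ≤ p' / q' + 1 / (q' q'')`
      have hα1 : (α * q' - p') * b < q' := by nlinarith
      have hα2 : (α * q' - p') * ((t * q' - q) * q') ≤ (α * q' - p') * b :=
        mul_le_mul_of_nonneg_left hss (sub_nonneg.2 hα)
      refine lt_of_mul_lt_mul_right (a := (q' : F)) ?_ hq0.le
      refine lt_of_mul_lt_mul_right (a := (q' : F)) ?_ hq0.le
      have hα3 : (α * q' - p') * ((t * q' - q) * q') < q' := hα2.trans_lt hα1
      linear_combination hα3 - (q' : F) * hd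

theorem exists_isFareyPair (hI : IsIntegerPart I) (hIE : ModelsIE1 I) (α : F)
    {N : I} (hN : (1 : F) ≤ N) :
    ∃ p q p' q' : I, IsFareyPair α N p q p' q' := by
  obtain ⟨c, hc, hc'⟩ := hI.exists_floor α
  obtain ⟨p, q, p', q', h1, h2, h3, h4, h5, h6, h7, h8⟩ :=
    exists_isFareyPair_of_floor_eq_zero hI hIE (sub_nonneg.2 hc) (by linarith : α - c < 1) hN
  refine ⟨p + c * q, q, p' + c * q', q', h1, h2, h3, h4, h5, ?_, ?_, ?_⟩
  · push_cast; linear_combination h6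
  · push_cast; linarith
  · push_cast; linarith

end Farey

/-! ### Approximation, density modulo one and separability -/

section Consequences

variable {F : Type*} [Field F] {I : Subring F}

theorem div_mem_fracField (a b : I) : (a : F) / b ∈ fracField I :=
  div_mem (Subfield.subset_closure a.2) (Subfield.subset_closure b.2)

variable [LinearOrder F] [IsStrictOrderedRing F]

theorem IsFareyPair.left_lt {α : F} (hα : α ∉ fracField I) {N p q p' q' : I}
    (h : IsFareyPair α N p q p' q') : (p : F) < α * q := by
  refine h.left.lt_of_ne fun he => hα ?_
  have hq : (q : F) ≠ 0 := (zero_lt_one.trans_le h.one_le).ne'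
  rw [eq_div_of_mul_eq hq he.symm]
  exact div_mem_fracField p q

/-- Dirichlet's approximation theorem with denominators bounded by the order of a Farey pair: the
member of the pair on the same side of the mediant as `α` satisfies both inequalities. The elements
`u`, `v` certify that `h` is invertible modulo `k`. -/
theorem exists_coprime_approx (hI : IsIntegerPart I) (hIE : ModelsIE1 I) {α : F} {N : I}
    (hN : (1 : F) ≤ N) :
    ∃ h k u v : I, (1 : F) ≤ k ∧ (h : F) * u - k * v = 1 ∧
      |α * k - h| * k < 1 ∧ |α * k - h| * N < 1 := by
  obtain ⟨p, q, p', q', hp⟩ := exists_isFareyPair hI hIE α hN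
  obtain ⟨h1, h2, h3, h4, h5, h6, h7, h8⟩ := hp
  have hlt : ∀ {D x y : F}, 0 ≤ D → 0 ≤ x → x < y → D * y ≤ 1 → D * x < 1 := by
    intro D x y hD hx hxy hy
    rcases hD.eq_or_lt with rfl | hD
    · simp
    · exact (mul_lt_mul_of_pos_left hxy hD).trans_le hy
  -- compare `α` with the mediant of the pair
  rcases le_total (α * (q + q')) (p + p') with hm | hm
  · have hD : 0 ≤ α * q - p := by linarith
    have hD1 : (α * q - p) * (q + q') ≤ 1 := by nlinarith
    refine ⟨p, q, -q', -p', h1, by push_cast; linear_combination h6, ?_, ?_⟩ <;>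
      rw [abs_of_nonneg hD]
    · exact hlt hD (by linarith) (by linarith) hD1
    · exact hlt hD (by linarith) (by linarith) hD1
  · have hD : 0 ≤ p' - α * q' := by linarith
    have hD1 : (p' - α * q') * (q + q') ≤ 1 := by nlinarith
    refine ⟨p', q', q, p, h2, by linear_combination h6, ?_, ?_⟩ <;>
      rw [abs_sub_comm, abs_of_nonneg hD]
    · exact hlt hD (by linarith) (by linarith) hD1
    · exact hlt hD (by linarith) (by linarith) hD1

/-- An irrational `α` stays away from all fractions of denominator at most `Q`, by a distance that
is read off from its Farey pair; no minimum over a (possibly infinite) initial segment is needed. -/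
theorem exists_pos_le_abs_mul_sub (hI : IsIntegerPart I) (hIE : ModelsIE1 I) {α : F}
    (hα : α ∉ fracField I) {Q : I} (hQ : (1 : F) ≤ Q) :
    ∃ δ : F, 0 < δ ∧ ∀ h k : I, (1 : F) ≤ k → (k : F) ≤ Q → δ ≤ |α * k - h| := by
  obtain ⟨p, q, p', q', hp⟩ := exists_isFareyPair hI hIE α hQ
  have hq : (0 : F) < q := zero_lt_one.trans_le hp.one_le
  have hq' : (0 : F) < q' := zero_lt_one.trans_le hp.one_le'
  have hl := hp.left_lt hα
  have hr := hp.right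
  refine ⟨min ((α * q - p) / q) ((p' - α * q') / q'), lt_min ?_ ?_, fun h k hk hkQ => ?_⟩
  · exact div_pos (by linarith) hq
  · exact div_pos (by linarith) hq'
  · rcases hp.left_or_right hI (c := h) hkQ with hc | hc
    · refine (min_le_left _ _).trans (le_trans ?_ (le_abs_self _))
      rw [div_le_iff₀ hq]
      nlinarith
    · refine (min_le_right _ _).trans (le_trans ?_ (neg_le_abs _))
      rw [div_le_iff₀ hq']
      nlinarith

/-- The denominators of good coprime approximations to an irrational are unbounded: the error is
made smaller than the distance of `α` to the fractions with small denominators. -/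
theorem exists_coprime_approx_gt (hI : IsIntegerPart I) (hIE : ModelsIE1 I) {α : F}
    (hα : α ∉ fracField I) (x : F) :
    ∃ h k u v : I, x < k ∧ (1 : F) ≤ k ∧ (h : F) * u - k * v = 1 ∧ |α * k - h| * k < 1 := by
  obtain ⟨Q, hQ⟩ := hI.exists_gt (max x 1)
  obtain ⟨hQx, hQ1⟩ := max_lt_iff.1 hQ
  obtain ⟨δ, hδ, hle⟩ := exists_pos_le_abs_mul_sub hI hIE hα hQ1.le
  obtain ⟨N, hN⟩ := hI.exists_gt (max (1 / δ) 1)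
  obtain ⟨hNδ, hN1⟩ := max_lt_iff.1 hN
  rw [div_lt_iff₀ hδ] at hNδ
  obtain ⟨h, k, u, v, hk, hd, hk', hkN⟩ := exists_coprime_approx hI hIE (α := α) hN1.le
  refine ⟨h, k, u, v, ?_, hk, hd, hk'⟩
  by_contra! hkx
  have := mul_le_mul_of_nonneg_right (hle h k hk (hkx.trans hQx.le)) (zero_le_one.trans hN1.le)
  linarith

theorem exists_abs_sub_div_lt (hI : IsIntegerPart I) (hIE : ModelsIE1 I) {α : F}
    (hα : α ∉ fracField I) (Q : F) :
    ∃ h ∈ I, ∃ k ∈ I, Q < k ∧ |α - h / k| < 1 / k ^ 2 := by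
  obtain ⟨h, k, -, -, hQ, hk, -, hlt⟩ := exists_coprime_approx_gt hI hIE hα Q
  refine ⟨h, h.2, k, k.2, hQ, ?_⟩
  have hk0 : (0 : F) < k := zero_lt_one.trans_le hk
  have he : α - h / k = (α * k - h) / k := by field_simp
  rw [he, abs_div, abs_of_pos hk0, div_lt_div_iff₀ hk0 (by positivity)]
  nlinarith

/-- If `h / k` approximates `α` with error less than `1 / k ^ 2` and `h` is invertible modulo `k`,
then `n = c h⁻¹ mod k` gives `nα ≡ c / k` modulo one, up to an error less than `1 / k`. -/
theorem dmoAt (hI : IsIntegerPart I) (hIE : ModelsIE1 I) {α : F} (hα : α ∉ fracField I) :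
    DMOAt I α := by
  intro l r hl hlr hr
  have hrl : 0 < r - l := sub_pos.2 hlr
  obtain ⟨h, k, u, v, hx, hk, hd, happ⟩ := exists_coprime_approx_gt hI hIE hα (3 / (r - l))
  rw [div_lt_iff₀ hrl] at hx
  have hk0 : (0 : F) < k := zero_lt_one.trans_le hk
  -- the numerator `c = c₀ + 2` satisfies `l < (c - 1) / k` and `(c + 1) / k < r`
  obtain ⟨c₀, hc₀, hc₀'⟩ := hI.exists_floor (l * k)
  -- `n` is the residue of `c u` modulo `k`, where `u` inverts `h`
  obtain ⟨s, hs, hs'⟩ := hI.exists_floor (((c₀ + 2 : F) * u) / k)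
  rw [le_div_iff₀ hk0] at hs
  rw [div_lt_iff₀ hk0] at hs'
  set n : I := (c₀ + 2) * u - s * k with hn
  have hnF : (n : F) = (c₀ + 2) * u - s * k := by rw [hn]; push_cast; rfl
  have hn0 : (0 : F) ≤ n := by rw [hnF]; linarith
  have hnk : (n : F) ≤ k := by rw [hnF]; linarith
  set a : I := (c₀ + 2) * v - s * h with ha
  have haF : (a : F) = (c₀ + 2) * v - s * h := by rw [ha]; push_cast; rfl
  have hnh : (n : F) * h = k * a + (c₀ + 2) := by
    rw [hnF, haF]; linear_combination ((c₀ : F) + 2) * hd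
  -- the error `n (α k - h)` is less than `1`
  have herr : |(n : F) * (α * k - h)| < 1 := by
    rw [abs_mul, abs_of_nonneg hn0, mul_comm]
    exact (mul_le_mul_of_nonneg_left hnk (abs_nonneg _)).trans_lt happ
  obtain ⟨he1, he2⟩ := abs_lt.1 herr
  have hlt1 : l < n * α - a := by
    refine lt_of_mul_lt_mul_right (a := (k : F)) ?_ hk0.le
    linear_combination he1 + hc₀' - hnh
  have hlt2 : n * α - a < r := by
    refine lt_of_mul_lt_mul_right (a := (k : F)) ?_ hk0.le
    linear_combination he2 + hc₀ + hx + hnh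
  exact ⟨n * α - a, ⟨n * α, ⟨n, n.2, hn0, rfl⟩, a, ⟨a.2, by linarith, by linarith⟩, rfl⟩,
    hlt1, hlt2⟩

/-- `⌊nα⌋ = m t + k` amounts to `nα / m - t ∈ [k / m, (k + 1) / m)`, so `DMO(α / m)` applies. -/
theorem propertyP (hI : IsIntegerPart I) (hIE : ModelsIE1 I) : PropertyP I := by
  intro α hα hα1 m hm k hk hk0 hkm
  have hm0 : 0 < m := hk0.trans_lt hkm
  have hαm : α / m ∉ fracField I := fun hmem => hα <| by
    rw [← div_mul_cancel₀ α hm0.ne']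
    exact mul_mem hmem (Subfield.subset_closure hm)
  have hk1 : k + 1 ≤ m := hI.add_one_le (a := ⟨k, hk⟩) (b := ⟨m, hm⟩) hkm
  obtain ⟨s, ⟨_, ⟨n, hn, hn0, rfl⟩, t, ⟨ht, ht1, ht2⟩, rfl⟩, hs1, hs2⟩ :=
    dmoAt hI hIE hαm (k / m) ((k + 1) / m) (by positivity)
      (div_lt_div_of_pos_right (by linarith) hm0) ((div_le_one hm0).2 hk1)
  have e : n * (α / m) - t = (n * α - m * t) / m := by field_simp
  rw [e, div_lt_div_iff_of_pos_right hm0] at hs1 hs2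
  have ht0 : 0 ≤ t := hI.le_of_lt_add_one (a := 0) (b := ⟨t, ht⟩)
    (lt_of_le_of_lt (by simp; positivity) ht2)
  refine ⟨m * t + k, ⟨⟨n, hn, hn0, add_mem (mul_mem hm ht) hk, by linarith, by linarith⟩,
    t, ht, ht0, rfl⟩, fun h0 => ?_⟩
  -- if `m t + k = 0`, then `0 < n α < 1`, which is impossible for `α > 1`
  have hmt : 0 ≤ m * t := by positivity
  have hn1 : (0 : F) < n := by
    refine hn0.lt_of_ne fun h => ?_
    rw [← h] at hs1
    linarith
  have hn2 : (0 : F) + 1 ≤ n := hI.add_one_le (a := 0) (b := ⟨n, hn⟩) (by simpa using hn1)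
  nlinarith

/-- For `α ≥ 1` the floors `⌊nα⌋` increase strictly with `n`, so no element `d > ⌊nα⌋` of `N_α`
lies below `⌊(n + 1)α⌋`. -/
theorem add_one_mul_lt_of_mem_floorMultiples (hI : IsIntegerPart I) {α : F} (hα : 1 ≤ α)
    {n c d : I} (hc : IsFloor I (n * α) c) (hcd : (c : F) < d) (hd : (d : F) ∈ floorMultiples I α) :
    ((n + 1 : I) : F) * α < d + 1 := by
  obtain ⟨j, hj, -, -, hj1, hj2⟩ := hd
  lift j to I using hj
  have hnj : (n : F) < j := by
    by_contra! h
    have h1 : (j : F) * α ≤ n * α := mul_le_mul_of_nonneg_right h (by linarith)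
    have h2 := hI.add_one_le hcd
    linarith [hc.2.2]
  have h1 := hI.add_one_le hnj
  push_cast
  nlinarith

/-- If `N_α = N_β`, then `⌊nα⌋ = ⌊nβ⌋` for all `n ≤ M`, by induction on `n`: the next floors are the
successors of the same element in the same set. The induction is carried out for the fractions
`p / q`, `p' / q'` with parameters in `I`, whose multiples have the same floors up to `M`. -/
theorem exists_common_floor_of_floorMultiples_eq (hI : IsIntegerPart I) (hIE : ModelsIE1 I)
    {α β : F} (hα : 1 ≤ α) (hβ : 1 ≤ β) (h : floorMultiples I α = floorMultiples I β) {M : I}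
    (hM : (1 : F) ≤ M) : ∃ c : I, IsFloor I (M * α) c ∧ IsFloor I (M * β) c := by
  obtain ⟨p, q, _, _, hp⟩ := exists_isFareyPair hI hIE α hM
  obtain ⟨p', q', _, _, hp'⟩ := exists_isFareyPair hI hIE β hM
  have hM0 : (0 : F) ≤ M := zero_le_one.trans hM
  have hp0 : 0 ≤ p := by
    have := (hp.le_mul_iff hI (c := 0) (k := 1) (by simp) (by simpa using hM)).1
      (by push_cast; linarith)
    have hpF : (0 : F) ≤ p := by simpa using this
    exact_mod_cast hpF
  refine Exists.imp ?_ (hIE.exists_common_floor (a := p) (b := q) (a' := p') (b' := q')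
    (M := M) hp0 (by exact_mod_cast hp.one_le) (by exact_mod_cast hp'.one_le) ?_
    (n := M) (by exact_mod_cast hM0) le_rfl)
  · rintro c ⟨h1, h2, h3, h4⟩
    exact ⟨(hp.isFloor_iff hI hM0 le_rfl).2 ⟨h1, h2⟩,
      (hp'.isFloor_iff hI hM0 le_rfl).2 ⟨h3, h4⟩⟩
  · intro n c hn hnM hc h1 h2 h3 h4
    have hn0 : (0 : F) ≤ n := by exact_mod_cast hn
    have hn0' : (0 : F) ≤ (n + 1 : I) := by push_cast; linarith
    have hnM' : ((n + 1 : I) : F) ≤ M := by exact_mod_cast hnM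
    have hnM0 : (n : F) ≤ M := by push_cast at hnM'; linarith
    have hcα := (hp.isFloor_iff hI hn0 hnM0).2 ⟨h1, h2⟩
    have hcβ := (hp'.isFloor_iff hI hn0 hnM0).2 ⟨h3, h4⟩
    obtain ⟨d, hd1, hd2⟩ := hI.exists_floor ((n + 1 : I) * α)
    obtain ⟨d', hd1', hd2'⟩ := hI.exists_floor ((n + 1 : I) * β)
    have hmem : (d : F) ∈ floorMultiples I β :=
      h ▸ ⟨(n + 1 : I), (n + 1).2, hn0', d.2, hd1, hd2⟩
    have hmem' : (d' : F) ∈ floorMultiples I α :=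
      h ▸ ⟨(n + 1 : I), (n + 1).2, hn0', d'.2, hd1', hd2'⟩
    have hsucc : ∀ {x : F}, 1 ≤ x → ∀ {e : I}, IsFloor I (n * x) c →
        ((n + 1 : I) : F) * x < e + 1 → (c : F) < e := by
      intro x hx e hcx he
      push_cast at he
      have := hcx.2.1
      linarith
    have hdd' : (d : F) ≤ d' := hI.le_of_lt_add_one <| hd1.trans_lt <|
      add_one_mul_lt_of_mem_floorMultiples hI hα hcα (hsucc hβ hcβ hd2') hmem'
    have hd'd : (d' : F) ≤ d := hI.le_of_lt_add_one <| hd1'.trans_lt <|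
      add_one_mul_lt_of_mem_floorMultiples hI hβ hcβ (hsucc hα hcα hd2) hmem
    obtain rfl : d = d' := Subtype.ext (le_antisymm hdd' hd'd)
    obtain ⟨h5, h6⟩ := (hp.isFloor_iff hI hn0' hnM').1 ⟨d.2, hd1, hd2⟩
    obtain ⟨h7, h8⟩ := (hp'.isFloor_iff hI hn0' hnM').1 ⟨d.2, hd1', hd2'⟩
    have hd0 : (0 : F) ≤ d := by
      have : (0 : F) ≤ c := by exact_mod_cast hc
      linarith [hsucc hα hcα hd2]
    exact ⟨d, by exact_mod_cast hd0, h5, h6, h7, h8⟩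

theorem separable (hI : IsIntegerPart I) (hIE : ModelsIE1 I) : Separable I := by
  intro α β hα hβ
  refine not_congr ⟨fun h => ?_, fun h => h ▸ rfl⟩
  by_contra hne
  have hpos : 0 < |α - β| := abs_pos.2 (sub_ne_zero.2 hne)
  obtain ⟨M, hM⟩ := hI.exists_gt (max (1 / |α - β|) 1)
  obtain ⟨hM1, hM2⟩ := max_lt_iff.1 hM
  rw [div_lt_iff₀ hpos] at hM1
  obtain ⟨c, ⟨-, h1, h2⟩, -, h3, h4⟩ :=
    exists_common_floor_of_floorMultiples_eq hI hIE hα hβ h hM2.le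
  have : |M * α - M * β| < 1 := abs_lt.2 ⟨by linarith, by linarith⟩
  rw [← mul_sub, abs_mul, abs_of_pos (zero_lt_one.trans hM2)] at this
  linarith

end Consequences
end SkolemBang

theorem corollary4p7 {F : Type*} [Field F] [LinearOrder F] [IsStrictOrderedRing F]
    (I : Subring F) (hI : SkolemBang.IsIntegerPart I) (hIE : SkolemBang.ModelsIE1 I) :
    (∀ α : F, α ∉ SkolemBang.fracField I → ∀ Q ∈ I, 0 < Q →
      ∃ h ∈ I, ∃ k ∈ I, Q < k ∧ |α - h / k| < 1 / k ^ 2) ∧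
    ((∃ α : F, α ∉ SkolemBang.fracField I) → SkolemBang.DMO I) ∧
    SkolemBang.PropertyP I ∧
    SkolemBang.Separable I := by
  refine ⟨fun α hα Q _ _ => SkolemBang.exists_abs_sub_div_lt hI hIE hα Q,
    fun h => ⟨h, fun α hα => SkolemBang.dmoAt hI hIE hα⟩,
    SkolemBang.propertyP hI hIE, SkolemBang.separable hI hIE⟩
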